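/- For $n\ge 0$ let $S_n$ be the group of permutations of $[n]=\{1,\dots,n\}$, generated by the simple transpositions $s_i=(i\ i{+}1)$, with product $(xy)(i)=x(y(i))$. Let $\le$ be the (strong) Bruhat order on $S_n$: $u\le v$ if some (not necessarily contiguous) subword of some reduced word for $v$ is a reduced word for $u$; write $\lessdot$ for its covering relation. Let $u\le v$ in $S_n$, and let the Bruhat interval polytope $\mathsf Q_{u,v}\subset\mathbb R^n$ be the convex hull of all vectors $(z(1),\dots,z(n))$ with $z\in S_n$, $u\le z\le v$. For a maximal chain $\mathcal C: u=x_{(0)}\lessdot x_{(1)}\lessdot\dots\lessdot x_{(l)}=v$ let $B_{\mathcal C}$ be the partition of $[n]$ into the connected components of the graph on $[n]$ in which distinct $a,b$ are adjacent if and only if $(a\,b)=x_{(i)}^{-1}x_{(i+1)}$ for some $0\le i\le l-1$. Then such a maximal chain exists, and $B_{\mathcal C}$ does not depend on the choice of $\mathcal C$. Denote it by $B_{u,v}=\{B^1,\dots,B^r\}$, and put $\#B_{u,v}=r$. The dimension of $\mathsf Q_{u,v}$ is $$\dim \mathsf Q_{u,v}=n-\#B_{u,v},$$ and the affine span of $\mathsf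 Q_{u,v}$ is the set of all $x\in\mathbb R^n$ with $$\sum_{i\in B^j}x_i=\sum_{i\in B^j}u(i)\;\Bigl(=\sum_{i\in B^j}v(i)\Bigr),\qquad j=1,\dots,r.$$ -/

import Mathlib

open Equiv

/-- A simple reflection of the symmetric group on `Fin n`: the transposition of two adjacent
positions. -/
def IsSimpleReflection {n : ℕ} (s : Perm (Fin n)) : Prop :=
  ∃ i j : Fin n, (i : ℕ) + 1 = (j : ℕ) ∧ s = swap i j

/-- `L` is a word in the simple reflections with product `w`. -/
def IsWord {n : ℕ} (L : List (Perm (Fin n))) (w : Perm (Fin n)) : Prop :=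
  (∀ s ∈ L, IsSimpleReflection s) ∧ L.prod = w

/-- `L` is a reduced word for `w`: a word for `w` of minimal length. -/
def IsReducedWord {n : ℕ} (L : List (Perm (Fin n))) (w : Perm (Fin n)) : Prop :=
  IsWord L w ∧ ∀ L' : List (Perm (Fin n)), IsWord L' w → L.length ≤ L'.length

/-- The (strong) Bruhat order: some (not necessarily contiguous) subword of some reduced word
for `v` is a reduced word for `u`. -/
def BruhatLE {n : ℕ} (u v : Perm (Fin n)) : Prop :=
  ∃ L K : List (Perm (Fin n)), IsReducedWord L v ∧ K.Sublist L ∧ IsReducedWord K u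

/-- The strict Bruhat order. -/
def BruhatLT {n : ℕ} (u v : Perm (Fin n)) : Prop :=
  BruhatLE u v ∧ u ≠ v

/-- The covering relation of the Bruhat order. -/
def BruhatCovBy {n : ℕ} (u v : Perm (Fin n)) : Prop :=
  BruhatLT u v ∧ ¬ ∃ z : Perm (Fin n), BruhatLT u z ∧ BruhatLT z v

/-- A finite sequence of permutations in which each one is covered by the next. -/
abbrev BruhatChain (n : ℕ) : Type :=
  RelSeries {p : Perm (Fin n) × Perm (Fin n) | BruhatCovBy p.1 p.2}

/-- `C` is a maximal chain of the Bruhat interval `[u, v]`. -/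
def IsMaximalChain {n : ℕ} (u v : Perm (Fin n)) (C : BruhatChain n) : Prop :=
  C.head = u ∧ C.last = v

/-- The graph on the positions `Fin n` whose edges are the transpositions
`(C i)⁻¹ * C (i + 1)` that label the steps of the chain `C`. -/
def chainGraph {n : ℕ} (C : BruhatChain n) : SimpleGraph (Fin n) where
  Adj a b := a ≠ b ∧ ∃ i : Fin C.length, (C i.castSucc)⁻¹ * C i.succ = swap a b
  symm := ⟨fun a b h => ⟨h.1.symm, h.2.imp fun _ hi => hi.trans (swap_comm a b)⟩⟩
  loopless := ⟨fun _ h => h.1 rfl⟩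

open Classical in
/-- The partition of `Fin n` into the connected components of `chainGraph C`. -/
noncomputable def chainPartition {n : ℕ} (C : BruhatChain n) :
    Finpartition (Finset.univ : Finset (Fin n)) :=
  Finpartition.ofSetoid (chainGraph C).reachableSetoid

/-- The vector `(z(1), …, z(n))`, with entries in `{1, …, n}`. -/
def permVec {n : ℕ} (z : Perm (Fin n)) : Fin n → ℝ :=
  fun i => ((z i : ℕ) : ℝ) + 1

/-- The Bruhat interval polytope: the convex hull of the vectors of the permutations in the
Bruhat interval `[u, v]`. -/
def bruhatIntervalPolytope {n : ℕ} (u v : Perm (Fin n)) : Set (Fin n → ℝ) :=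
  convexHull ℝ {x | ∃ z : Perm (Fin n), BruhatLE u z ∧ BruhatLE z v ∧ x = permVec z}

/-!
The key point is that a left coset `u W` of a Young subgroup `W` which contains one saturated chain
from `u` to `v` contains the whole Bruhat interval `[u, v]` (`ColorChain.valueColoring_eq`). Here
`W` is the group of permutations of positions preserving a colouring `f`, and two permutations lie
in the same left coset exactly when they induce the same colouring of the values.

Left multiplication does not change the labels `x⁻¹ * y`, so the coset statement can be proved by
induction on `v`, removing a left descent `s`. A saturated chain ending in `v` is turned into one
ending in `s * v` (`ColorChain.simple_mul`): a step `x ⋖ y` between two left descents becomes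
`s * x ⋖ s * y`, a step from an ascent to a descent must be `x ⋖ s * x` and is removed, and the
other steps stay, because the coset is stable under `s` once it contains both `x` and `s * x`. A
step `x ⋖ y` from a descent to an ascent is preceded by the new step `s * x ⋖ x`. The lifting property then moves
the elements of `[u, v]` into the interval below `s * v`. The lifting property itself is immediate
for the transitive closure of the Bruhat edges (`BruhatEdge.eq_or_mul_left`), and this closure is
the subword order (`bruhatLE_iff_edgePath`).

Take for `f` the map sending a position to its component in the graph of a maximal chain `C`. Every
other maximal chain `D` lies in the same coset, so its labels preserve the components of `C`; by
symmetry `C` and `D` have the same partition. For the same reason each `z` in `[u, v]` has the same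
sum as `u` over each block, so the affine span satisfies the block equations. Conversely, a step
labelled `swap a b` moves the vector of a permutation by a nonzero multiple of `e a - e b`, and the
differences `e a - e b` for `a`, `b` in a common block span the kernel of the block sums, which has
dimension `n` minus the number of blocks.
-/

/-! ### Bruhat edges and left multiplication by simple reflections -/

/-- `BruhatEdge x y`: the permutation `y` arises from `x` by exchanging the values at two positions
which `x` does not invert. -/
def BruhatEdge {n : ℕ} (x y : Perm (Fin n)) : Prop :=
  ∃ a b : Fin n, a < b ∧ x a < x b ∧ y = x * swap a b

theorem IsSimpleReflection.mul_self {n : ℕ} {s : Perm (Fin n)} (hs : IsSimpleReflection s) :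
    s * s = 1 := by
  obtain ⟨i, j, -, rfl⟩ := hs
  exact swap_mul_self i j

theorem IsSimpleReflection.mul_mul_cancel {n : ℕ} {s : Perm (Fin n)} (hs : IsSimpleReflection s)
    (w : Perm (Fin n)) : s * (s * w) = w := by
  rw [← mul_assoc, hs.mul_self, one_mul]

theorem IsSimpleReflection.edge_or_edge {n : ℕ} {s : Perm (Fin n)} (hs : IsSimpleReflection s)
    (w : Perm (Fin n)) : BruhatEdge w (s * w) ∨ BruhatEdge (s * w) w := by
  obtain ⟨i, j, hij, rfl⟩ := hs
  have hlt : i < j := by rw [Fin.lt_def]; omega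
  have hmul : swap i j * w = w * swap (w⁻¹ i) (w⁻¹ j) := by
    rw [swap_apply_apply]; group
  rcases lt_or_gt_of_ne (fun h : w⁻¹ i = w⁻¹ j => hlt.ne (w⁻¹.injective h)) with h | h
  · exact Or.inl ⟨_, _, h, by simpa using hlt, hmul⟩
  · refine Or.inr ⟨_, _, h, ?_, ?_⟩
    · simpa using hlt
    · rw [hmul, swap_comm, mul_assoc, swap_mul_self, mul_one]

/-- Left multiplication by a simple reflection `s = (i j)` preserves the relative order of any two
values except `i` and `j`, hence preserves every edge but `x → s * x`. -/
theorem BruhatEdge.eq_or_mul_left {n : ℕ} {s x y : Perm (Fin n)} (hs : IsSimpleReflection s)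
    (h : BruhatEdge x y) : y = s * x ∨ BruhatEdge (s * x) (s * y) := by
  obtain ⟨i, j, hij, rfl⟩ := hs
  obtain ⟨a, b, hab, hx, rfl⟩ := h
  by_cases h : x a = i ∧ x b = j
  · left
    rw [← h.1, ← h.2, swap_apply_apply]; group
  · right
    refine ⟨a, b, hab, ?_, (mul_assoc _ _ _).symm⟩
    -- As `i` and `j` are consecutive, `s` is monotone on the pair `x a < x b`.
    rw [Perm.mul_apply, Perm.mul_apply]
    rw [Fin.lt_def] at hx ⊢
    simp only [Fin.ext_iff] at h
    simp only [swap_apply_def, Fin.ext_iff]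
    split_ifs <;> omega

/-- The transitive form of the Bruhat order: a sequence of Bruhat edges leads from `x` to `y`. -/
abbrev EdgePath {n : ℕ} : Perm (Fin n) → Perm (Fin n) → Prop :=
  Relation.ReflTransGen BruhatEdge

/-- Multiply the edges of the path by `s`; an edge `z → s * z` cannot be multiplied, but a path from
`s * x` to `s * z` already ends at its target. -/
theorem EdgePath.mul_left_source {n : ℕ} {s x y : Perm (Fin n)} (hs : IsSimpleReflection s)
    (h : EdgePath x y) : EdgePath (s * x) y ∨ EdgePath (s * x) (s * y) := by
  induction h with
  | refl => exact Or.inr .refl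
  | @tail y z _ hyz ih =>
    rcases ih with ih | ih
    · exact Or.inl (ih.tail hyz)
    · rcases hyz.eq_or_mul_left hs with rfl | h
      · exact Or.inl ih
      · exact Or.inr (ih.tail h)

theorem EdgePath.mul_left_target {n : ℕ} {s x y : Perm (Fin n)} (hs : IsSimpleReflection s)
    (h : EdgePath x y) : EdgePath x (s * y) ∨ EdgePath (s * x) (s * y) := by
  induction h using Relation.ReflTransGen.head_induction_on with
  | refl => exact Or.inr .refl
  | @head x z hxz _ ih =>
    rcases ih with ih | ih
    · exact Or.inl (ih.head hxz)
    · rcases hxz.eq_or_mul_left hs with rfl | h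
      · rw [hs.mul_mul_cancel] at ih
        exact Or.inl ih
      · exact Or.inr (ih.head h)

/-! ### Inversions and reduced words -/

/-- The number of inversions of a permutation. -/
def invCount {n : ℕ} (w : Perm (Fin n)) : ℕ :=
  (Finset.univ.filter fun p : Fin n × Fin n => p.1 < p.2 ∧ w p.2 < w p.1).card

theorem invCount_simple_mul {n : ℕ} {s w : Perm (Fin n)} (hs : IsSimpleReflection s)
    (h : BruhatEdge w (s * w)) : invCount (s * w) = invCount w + 1 := by
  obtain ⟨i, j, hij, rfl⟩ := hs
  obtain ⟨a, b, hab, hw, he⟩ := h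
  have hlt : i < j := by rw [Fin.lt_def]; omega
  have he' : swap i j = swap (w a) (w b) := by
    rw [swap_apply_apply, ← he]; group
  have hwab : w a = i ∧ w b = j := by
    have h1 := congrArg (fun f : Perm (Fin n) => f (w a)) he'
    have h2 := congrArg (fun f : Perm (Fin n) => f i) he'
    simp only [swap_apply_left, swap_apply_def, Fin.ext_iff] at h1 h2
    rw [Fin.lt_def] at hw
    simp only [Fin.ext_iff]
    split_ifs at h1 h2 <;> omega
  obtain ⟨rfl, rfl⟩ := hwab
  rw [invCount, invCount, ← Finset.card_insert_of_notMem (a := (a, b))]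
  · congr 1
    ext ⟨c, d⟩
    have hc : w c = w a ↔ c = a := w.injective.eq_iff
    have hc' : w c = w b ↔ c = b := w.injective.eq_iff
    have hd : w d = w a ↔ d = a := w.injective.eq_iff
    have hd' : w d = w b ↔ d = b := w.injective.eq_iff
    rw [Finset.mem_insert, Finset.mem_filter, Finset.mem_filter]
    simp only [Finset.mem_univ, true_and, Prod.mk.injEq, Perm.mul_apply, swap_apply_def]
    simp only [Fin.ext_iff, Fin.lt_def] at *
    split_ifs <;> omega
  · simp only [Finset.mem_filter, Finset.mem_univ, true_and, not_and, not_lt]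
    exact fun _ => hw.le

theorem invCount_one {n : ℕ} : invCount (1 : Perm (Fin n)) = 0 := by
  rw [invCount, Finset.card_eq_zero, Finset.filter_eq_empty_iff]
  exact fun p _ h => lt_asymm h.1 h.2

/-- A permutation without left descents has a strictly monotone inverse, so it is the identity. -/
theorem exists_simple_descent {n : ℕ} {w : Perm (Fin n)} (hw : w ≠ 1) :
    ∃ s : Perm (Fin n), IsSimpleReflection s ∧ BruhatEdge (s * w) w := by
  by_contra! hno
  have hmono : StrictMono (w⁻¹ : Perm (Fin n)) := by
    obtain _ | n := n
    · exact fun i => i.elim0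
    · refine Fin.strictMono_iff_lt_succ.2 fun i => ?_
      have hs : IsSimpleReflection (swap i.castSucc i.succ) := ⟨_, _, by simp, rfl⟩
      by_contra hlt
      refine hno _ hs ⟨w⁻¹ i.succ, w⁻¹ i.castSucc, lt_of_le_of_ne (not_lt.1 hlt) ?_, ?_, ?_⟩
      · exact fun h => (Fin.castSucc_lt_succ (i := i)).ne' (w⁻¹.injective h)
      · simp
      · rw [swap_comm, swap_apply_apply]; group; simp
  refine hw (inv_eq_one.1 (Equiv.ext fun i => ?_))
  have := congrArg (fun e : Fin n ≃o Fin n => e i)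
    (Subsingleton.elim (hmono.orderIsoOfSurjective _ w⁻¹.surjective) (OrderIso.refl _))
  simpa using this

theorem IsWord.invCount_le {n : ℕ} {L : List (Perm (Fin n))} {w : Perm (Fin n)}
    (h : IsWord L w) : invCount w ≤ L.length := by
  induction L generalizing w with
  | nil =>
    obtain ⟨-, rfl⟩ := h
    simp [invCount_one]
  | cons s L ih =>
    obtain ⟨hL, rfl⟩ := h
    have hs := hL s List.mem_cons_self
    have := ih ⟨fun t ht => hL t (List.mem_cons_of_mem _ ht), rfl⟩
    rw [List.prod_cons, List.length_cons]
    rcases hs.edge_or_edge L.prod with h | h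
    · rw [invCount_simple_mul hs h]; omega
    · have h2 := invCount_simple_mul (w := s * L.prod) hs (by rwa [hs.mul_mul_cancel])
      rw [hs.mul_mul_cancel] at h2
      omega

theorem invCount_of_descent {n : ℕ} {s w : Perm (Fin n)} (hs : IsSimpleReflection s)
    (h : BruhatEdge (s * w) w) : invCount w = invCount (s * w) + 1 := by
  have h2 := invCount_simple_mul (w := s * w) hs (by rwa [hs.mul_mul_cancel])
  rwa [hs.mul_mul_cancel] at h2

theorem IsWord.cons {n : ℕ} {L : List (Perm (Fin n))} {s w : Perm (Fin n)}
    (hs : IsSimpleReflection s) (h : IsWord L (s * w)) : IsWord (s :: L) w := by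
  refine ⟨fun t ht => ?_, by rw [List.prod_cons, h.2, hs.mul_mul_cancel]⟩
  rcases List.mem_cons.1 ht with rfl | ht
  exacts [hs, h.1 t ht]

/-- Induction along left descents: every permutation is reached from the identity by repeatedly
multiplying on the left with simple reflections that increase the number of inversions. -/
theorem descent_induction {n : ℕ} {P : Perm (Fin n) → Prop} (one : P 1)
    (step : ∀ s w, IsSimpleReflection s → BruhatEdge (s * w) w → P (s * w) → P w)
    (w : Perm (Fin n)) : P w := by
  induction hk : invCount w using Nat.strong_induction_on generalizing w with
  | _ k ih =>
    by_cases hw : w = 1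
    · rwa [hw]
    · obtain ⟨s, hs, h⟩ := exists_simple_descent hw
      have := invCount_of_descent hs h
      exact step s w hs h (ih _ (by omega) _ rfl)

theorem exists_isWord_length_eq {n : ℕ} (w : Perm (Fin n)) :
    ∃ L, IsWord L w ∧ L.length = invCount w := by
  induction w using descent_induction with
  | one => exact ⟨[], ⟨by simp, rfl⟩, by simp [invCount_one]⟩
  | step s w hs h ih =>
    obtain ⟨L, hL, hlen⟩ := ih
    exact ⟨s :: L, hL.cons hs, by rw [List.length_cons, hlen, invCount_of_descent hs h]⟩

theorem isReducedWord_iff {n : ℕ} {L : List (Perm (Fin n))} {w : Perm (Fin n)} :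
    IsReducedWord L w ↔ IsWord L w ∧ L.length = invCount w := by
  constructor
  · rintro ⟨hL, hmin⟩
    obtain ⟨L', hL', hlen⟩ := exists_isWord_length_eq w
    exact ⟨hL, le_antisymm (hlen ▸ hmin L' hL') hL.invCount_le⟩
  · rintro ⟨hL, hlen⟩
    exact ⟨hL, fun L' hL' => hlen ▸ hL'.invCount_le⟩

theorem IsReducedWord.cons {n : ℕ} {L : List (Perm (Fin n))} {s w : Perm (Fin n)}
    (hs : IsSimpleReflection s) (hw : BruhatEdge (s * w) w) (h : IsReducedWord L (s * w)) :
    IsReducedWord (s :: L) w := by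
  rw [isReducedWord_iff] at h ⊢
  exact ⟨h.1.cons hs, by rw [List.length_cons, h.2, invCount_of_descent hs hw]⟩

/-! ### The subword order is the transitive closure of the edges -/

theorem EdgePath.of_sublist {n : ℕ} {K L : List (Perm (Fin n))} (hKL : K.Sublist L)
    (hL : ∀ s ∈ L, IsSimpleReflection s) (hlen : L.length = invCount L.prod) :
    EdgePath K.prod L.prod := by
  induction hKL with
  | slnil => exact .refl
  | @cons K L s _ ih | @cons_cons K L s _ ih =>
    have hs := hL s List.mem_cons_self
    have hL' : ∀ t ∈ L, IsSimpleReflection t := fun t ht => hL t (List.mem_cons_of_mem _ ht)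
    have hle : invCount L.prod ≤ L.length := IsWord.invCount_le ⟨hL', rfl⟩
    rw [List.prod_cons, List.length_cons] at hlen
    -- A suffix of a reduced word is reduced, and prepending its first letter goes up.
    have hup : BruhatEdge L.prod (s * L.prod) := by
      refine (hs.edge_or_edge _).resolve_right fun h => ?_
      have := invCount_of_descent hs h
      omega
    have hlen' : L.length = invCount L.prod := by
      have := invCount_simple_mul hs hup
      omega
    have hpath := ih hL' hlen'
    simp only [List.prod_cons]
    first
    | exact hpath.tail hup
    | exact (hpath.mul_left_source hs).elim (fun h => h.tail hup) id

theorem EdgePath.eq_one {n : ℕ} {x : Perm (Fin n)} (h : EdgePath x 1) : x = 1 := by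
  rcases Relation.ReflTransGen.cases_tail h with h | ⟨y, -, a, b, hab, hy, h⟩
  · exact h.symm
  · -- The last edge would start at `swap a b`, which already inverts the positions `a < b`.
    rw [eq_comm, mul_eq_one_iff_eq_inv, swap_inv] at h
    subst h
    rw [swap_apply_left, swap_apply_right] at hy
    exact absurd hab hy.asymm

theorem isReducedWord_nil {n : ℕ} : IsReducedWord [] (1 : Perm (Fin n)) :=
  ⟨⟨by simp, rfl⟩, fun _ _ => by simp⟩

theorem EdgePath.bruhatLE {n : ℕ} {u v : Perm (Fin n)} (h : EdgePath u v) : BruhatLE u v := by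
  induction v using descent_induction generalizing u with
  | one => exact ⟨[], [], isReducedWord_nil, .slnil, h.eq_one ▸ isReducedWord_nil⟩
  | step s v hs hv ih =>
    rcases hs.edge_or_edge u with hu | hu
    · obtain ⟨L, K, hL, hKL, hK⟩ := ih ((h.mul_left_target hs).elim id fun h => h.head hu)
      exact ⟨s :: L, K, hL.cons hs hv, hKL.cons s, hK⟩
    · obtain ⟨L, K, hL, hKL, hK⟩ := ih ((h.mul_left_target hs).elim (fun h => h.head hu) id)
      exact ⟨s :: L, s :: K, hL.cons hs hv, hKL.cons_cons s, hK.cons hs hu⟩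

theorem bruhatLE_iff_edgePath {n : ℕ} {u v : Perm (Fin n)} : BruhatLE u v ↔ EdgePath u v := by
  refine ⟨?_, EdgePath.bruhatLE⟩
  rintro ⟨L, K, hL, hKL, hK⟩
  rw [isReducedWord_iff] at hL
  obtain ⟨⟨hL, rfl⟩, hlen⟩ := hL
  rw [← hK.1.2]
  exact .of_sublist hKL hL hlen

theorem BruhatLE.refl {n : ℕ} (u : Perm (Fin n)) : BruhatLE u u :=
  bruhatLE_iff_edgePath.2 .refl

theorem BruhatLE.trans {n : ℕ} {u v w : Perm (Fin n)} (h : BruhatLE u v) (h' : BruhatLE v w) :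
    BruhatLE u w := by
  rw [bruhatLE_iff_edgePath] at *
  exact Relation.ReflTransGen.trans h h'

theorem BruhatEdge.bruhatLE {n : ℕ} {u v : Perm (Fin n)} (h : BruhatEdge u v) : BruhatLE u v :=
  bruhatLE_iff_edgePath.2 (.single h)

theorem BruhatEdge.ne {n : ℕ} {u v : Perm (Fin n)} (h : BruhatEdge u v) : u ≠ v := by
  obtain ⟨a, b, hab, -, rfl⟩ := h
  rw [Ne, left_eq_mul, swap_eq_one_iff]
  exact hab.ne

theorem BruhatLT.invCount_lt {n : ℕ} {u v : Perm (Fin n)} (h : BruhatLT u v) :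
    invCount u < invCount v := by
  obtain ⟨⟨L, K, hL, hKL, hK⟩, hne⟩ := h
  rw [isReducedWord_iff] at hL hK
  rw [← hL.2, ← hK.2]
  refine lt_of_le_of_ne hKL.length_le fun hlen => hne ?_
  rw [← hK.1.2, ← hL.1.2, hKL.eq_of_length hlen]

theorem BruhatLE.antisymm {n : ℕ} {u v : Perm (Fin n)} (h : BruhatLE u v) (h' : BruhatLE v u) :
    u = v := by
  by_contra hne
  exact lt_asymm (BruhatLT.invCount_lt ⟨h, hne⟩) (BruhatLT.invCount_lt ⟨h', Ne.symm hne⟩)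

/-! ### Lifting and covers -/

theorem BruhatLE.simple_mul_le {n : ℕ} {s x y : Perm (Fin n)} (hs : IsSimpleReflection s)
    (hy : BruhatEdge (s * y) y) (h : BruhatLE x y) : BruhatLE (s * x) y := by
  rw [bruhatLE_iff_edgePath] at *
  exact (h.mul_left_source hs).elim id fun h => h.tail hy

theorem BruhatLE.simple_mul_le_simple_mul_of_ascent {n : ℕ} {s x y : Perm (Fin n)}
    (hs : IsSimpleReflection s) (hy : BruhatEdge y (s * y)) (h : BruhatLE x y) :
    BruhatLE (s * x) (s * y) := by
  rw [bruhatLE_iff_edgePath] at *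
  exact (h.mul_left_source hs).elim (fun h => h.tail hy) id

theorem BruhatLE.simple_mul_le_simple_mul_of_descent {n : ℕ} {s x y : Perm (Fin n)}
    (hs : IsSimpleReflection s) (hx : BruhatEdge (s * x) x) (h : BruhatLE x y) :
    BruhatLE (s * x) (s * y) := by
  rw [bruhatLE_iff_edgePath] at *
  exact (h.mul_left_target hs).elim (fun h => h.head hx) id

theorem BruhatLE.le_simple_mul {n : ℕ} {s x y : Perm (Fin n)} (hs : IsSimpleReflection s)
    (hx : BruhatEdge x (s * x)) (h : BruhatLE x y) : BruhatLE x (s * y) := by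
  rw [bruhatLE_iff_edgePath] at *
  exact (h.mul_left_target hs).elim id fun h => h.head hx

theorem BruhatCovBy.eq_or_eq {n : ℕ} {x y z : Perm (Fin n)} (h : BruhatCovBy x y)
    (hxz : BruhatLE x z) (hzy : BruhatLE z y) : z = x ∨ z = y := by
  by_contra! hne
  exact h.2 ⟨z, ⟨hxz, hne.1.symm⟩, hzy, hne.2⟩

theorem BruhatCovBy.edge {n : ℕ} {x y : Perm (Fin n)} (h : BruhatCovBy x y) : BruhatEdge x y := by
  rcases Relation.ReflTransGen.cases_head (bruhatLE_iff_edgePath.1 h.1.1) with he | ⟨z, hxz, hzy⟩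
  · exact absurd he h.1.2
  · rcases h.eq_or_eq hxz.bruhatLE (EdgePath.bruhatLE hzy) with rfl | rfl
    · exact absurd rfl hxz.ne
    · exact hxz

/-- The only cover that leads from an ascent of `s` to a descent of `s` is `x ⋖ s * x`. -/
theorem BruhatCovBy.eq_simple_mul {n : ℕ} {s x y : Perm (Fin n)} (hs : IsSimpleReflection s)
    (h : BruhatCovBy x y) (hx : BruhatEdge x (s * x)) (hy : BruhatEdge (s * y) y) : y = s * x :=
  ((h.eq_or_eq hx.bruhatLE (h.1.1.simple_mul_le hs hy)).resolve_left hx.ne.symm).symm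

theorem bruhatCovBy_of_descent {n : ℕ} {s x : Perm (Fin n)} (hs : IsSimpleReflection s)
    (hx : BruhatEdge (s * x) x) : BruhatCovBy (s * x) x := by
  refine ⟨⟨hx.bruhatLE, hx.ne⟩, ?_⟩
  rintro ⟨z, hxz, hzx⟩
  have h1 := hxz.invCount_lt
  have h2 := hzx.invCount_lt
  have h3 := invCount_of_descent hs hx
  omega

/-- A simple reflection that is a left descent of both ends of a cover carries it to a cover. -/
theorem BruhatCovBy.simple_mul {n : ℕ} {s x y : Perm (Fin n)} (hs : IsSimpleReflection s)
    (h : BruhatCovBy x y) (hx : BruhatEdge (s * x) x) (hy : BruhatEdge (s * y) y) :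
    BruhatCovBy (s * x) (s * y) := by
  refine ⟨⟨h.1.1.simple_mul_le_simple_mul_of_descent hs hx, fun he => h.1.2 (mul_left_cancel he)⟩,
    ?_⟩
  rintro ⟨z, hxz, hzy⟩
  rcases hs.edge_or_edge z with hz | hz
  · have h1 : BruhatLE x (s * z) := by
      simpa only [hs.mul_mul_cancel] using hxz.1.simple_mul_le_simple_mul_of_ascent hs hz
    have h2 : BruhatLE (s * z) y := by
      simpa only [hs.mul_mul_cancel] using
        hzy.1.simple_mul_le_simple_mul_of_ascent hs (y := s * y) (by rwa [hs.mul_mul_cancel])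
    rcases h.eq_or_eq h1 h2 with he | he
    · exact hxz.2 (by rw [← he, hs.mul_mul_cancel])
    · exact hzy.2 (by rw [← he, hs.mul_mul_cancel])
  · have h1 : BruhatLE x z := by
      simpa only [hs.mul_mul_cancel] using hxz.1.simple_mul_le hs hz
    rcases h.eq_or_eq h1 (hzy.1.trans hy.bruhatLE) with rfl | rfl
    · rcases h.eq_or_eq hzy.1 hy.bruhatLE with he | he
      · exact hzy.2 he.symm
      · exact hy.ne he
    · exact hy.ne (hy.bruhatLE.antisymm hzy.1)

/-! ### Convexity of Young cosets joined by a saturated chain -/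

/-- The colouring of the values of `x` obtained by carrying the colouring `f` of the positions
along `x`. The permutations sharing a given value colouring form a left coset of the Young subgroup
of permutations preserving `f`. -/
def valueColoring {n : ℕ} {α : Type*} (f : Fin n → α) (x : Perm (Fin n)) : Fin n → α :=
  fun i => f (x⁻¹ i)

theorem valueColoring_simple_mul {n : ℕ} {α : Type*} (f : Fin n → α) {s : Perm (Fin n)}
    (x : Perm (Fin n)) :
    valueColoring f (s * x) = valueColoring f x ∘ ⇑s⁻¹ := by
  funext i
  simp [valueColoring]

theorem valueColoring_mul_left_inj {n : ℕ} {α : Type*} {f : Fin n → α} {s x y : Perm (Fin n)} :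
    valueColoring f (s * x) = valueColoring f (s * y) ↔ valueColoring f x = valueColoring f y := by
  rw [valueColoring_simple_mul, valueColoring_simple_mul]
  exact s⁻¹.surjective.injective_comp_right.eq_iff

theorem valueColoring_mul_swap_eq_iff {n : ℕ} {α : Type*} {f : Fin n → α} {x : Perm (Fin n)}
    {a b : Fin n} : valueColoring f (x * swap a b) = valueColoring f x ↔ f a = f b := by
  constructor
  · intro h
    simpa [valueColoring] using (congrFun h (x a)).symm
  · intro h
    funext i
    simp only [valueColoring, mul_inv_rev, swap_inv, Perm.mul_apply, swap_apply_def]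
    split_ifs with h1 h2
    · rw [h1, h]
    · rw [h2, h]
    · rfl

/-- `ColorChain f u v`: a saturated chain leads from `u` to `v` inside one left coset of the Young
subgroup of permutations preserving `f`. -/
def ColorChain {n : ℕ} {α : Type*} (f : Fin n → α) : Perm (Fin n) → Perm (Fin n) → Prop :=
  Relation.ReflTransGen fun x y => BruhatCovBy x y ∧ valueColoring f x = valueColoring f y

theorem ColorChain.cons {n : ℕ} {α : Type*} {f : Fin n → α} {x y z : Perm (Fin n)}
    (h : ColorChain f y z) (hxy : BruhatCovBy x y) (hcol : valueColoring f x = valueColoring f y) :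
    ColorChain f x z :=
  Relation.ReflTransGen.head ⟨hxy, hcol⟩ h

/-- A coset chain from `u` to `v` and a left descent `s` of `v` give a coset chain ending in
`s * v`, starting at `s * u` or `u` according to whether `s` is a left descent of `u` or not. A step
between two elements with left descent `s` is multiplied by `s`; a step from an ascent to a descent
is `x ⋖ s * x` and is dropped; a step between two ascents is kept; a step `x ⋖ y` from a descent to
an ascent is replaced by `s * x ⋖ x ⋖ y`. If the chain contains an ascent, then it also contains a
step `x ⋖ s * x`, so that the coset is stable under `s`. -/
theorem ColorChain.simple_mul {n : ℕ} {α : Type*} {f : Fin n → α} {s u v : Perm (Fin n)}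
    (hs : IsSimpleReflection s) (h : ColorChain f u v) (hv : BruhatEdge (s * v) v) :
    (BruhatEdge (s * u) u ∧ ColorChain f (s * u) (s * v)) ∨
      (BruhatEdge u (s * u) ∧ valueColoring f (s * u) = valueColoring f u ∧
        ColorChain f u (s * v)) := by
  induction h using Relation.ReflTransGen.head_induction_on with
  | refl => exact Or.inl ⟨hv, .refl⟩
  | @head u x hux _ ih =>
    rcases ih with ⟨hx, ih⟩ | ⟨hx, hcol, ih⟩ <;> rcases hs.edge_or_edge u with hu | hu
    · have hxu := hux.1.eq_simple_mul hs hu hx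
      subst hxu
      rw [hs.mul_mul_cancel] at ih
      exact Or.inr ⟨hu, hux.2.symm, ih⟩
    · exact Or.inl ⟨hu, ih.cons (hux.1.simple_mul hs hu hx)
        (valueColoring_mul_left_inj.2 hux.2)⟩
    · refine Or.inr ⟨hu, ?_, ih.cons hux.1 hux.2⟩
      rw [hux.2, ← hcol]
      exact valueColoring_mul_left_inj.2 hux.2
    · refine Or.inl ⟨hu, (ih.cons hux.1 hux.2).cons (bruhatCovBy_of_descent hs hu) ?_⟩
      rw [hux.2, ← hcol]
      exact valueColoring_mul_left_inj.2 hux.2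

/-- A coset of a Young subgroup containing a saturated chain from `u` to `v` contains the whole
Bruhat interval. -/
theorem ColorChain.valueColoring_eq {n : ℕ} {α : Type*} {f : Fin n → α} {u v z : Perm (Fin n)}
    (h : ColorChain f u v) (huz : BruhatLE u z) (hzv : BruhatLE z v) :
    valueColoring f z = valueColoring f u := by
  induction v using descent_induction generalizing u z with
  | one =>
    have hz := (bruhatLE_iff_edgePath.1 hzv).eq_one
    rw [hz] at huz ⊢
    rw [(bruhatLE_iff_edgePath.1 huz).eq_one]
  | step s v hs hv ih =>
    rcases h.simple_mul hs hv with ⟨hu, h⟩ | ⟨hu, hcol, h⟩ <;>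
      rcases hs.edge_or_edge z with hz | hz
    · -- Here `s * u ≤ u ≤ z ≤ s * v`: both `u` and `z` lie in the interval `[s * u, s * v]`.
      have hzv' := hzv.le_simple_mul hs hz
      rw [ih h (hu.bruhatLE.trans huz) hzv', ih h hu.bruhatLE (huz.trans hzv')]
    · exact valueColoring_mul_left_inj.1 (ih h (huz.simple_mul_le_simple_mul_of_descent hs hu)
        (hzv.simple_mul_le_simple_mul_of_descent hs hz))
    · exact ih h huz (hzv.le_simple_mul hs hz)
    · rw [← valueColoring_mul_left_inj (s := s), hcol]
      exact ih h (huz.le_simple_mul hs hu) (hzv.simple_mul_le_simple_mul_of_descent hs hz)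

/-! ### Maximal chains -/

theorem BruhatCovBy.exists_swap {n : ℕ} {x y : Perm (Fin n)} (h : BruhatCovBy x y) :
    ∃ a b : Fin n, a ≠ b ∧ y = x * swap a b := by
  obtain ⟨a, b, hab, -, rfl⟩ := h.edge
  exact ⟨a, b, hab.ne, rfl⟩

theorem exists_isMaximalChain {n : ℕ} {u v : Perm (Fin n)} (h : BruhatLE u v) :
    ∃ C : BruhatChain n, IsMaximalChain u v C := by
  induction hk : invCount v - invCount u using Nat.strong_induction_on generalizing u v with
  | _ k ih =>
    by_cases huv : u = v
    · exact ⟨RelSeries.singleton _ u, rfl, huv⟩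
    by_cases hcov : BruhatCovBy u v
    · exact ⟨(RelSeries.singleton _ v).cons u hcov, RelSeries.head_cons .., RelSeries.last_cons ..⟩
    · obtain ⟨z, huz, hzv⟩ := not_not.1 fun hz => hcov ⟨⟨h, huv⟩, hz⟩
      have h1 := huz.invCount_lt
      have h2 := hzv.invCount_lt
      obtain ⟨C, hC⟩ := ih _ (by omega) huz.1 rfl
      obtain ⟨D, hD⟩ := ih _ (by omega) hzv.1 rfl
      refine ⟨C.smash D (hC.2.trans hD.1.symm), ?_, ?_⟩
      · rw [RelSeries.head_smash, hC.1]
      · rw [RelSeries.last_smash, hD.2]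

theorem BruhatChain.covBy {n : ℕ} (C : BruhatChain n) (i : Fin C.length) :
    BruhatCovBy (C i.castSucc) (C i.succ) :=
  C.step i

theorem IsMaximalChain.bruhatLE_apply {n : ℕ} {u v : Perm (Fin n)} {C : BruhatChain n}
    (hC : IsMaximalChain u v C) (i : Fin (C.length + 1)) : BruhatLE u (C i) := by
  induction i using Fin.induction with
  | zero => exact hC.1 ▸ .refl _
  | succ i ih => exact ih.trans (C.covBy i).1.1

theorem IsMaximalChain.apply_bruhatLE {n : ℕ} {u v : Perm (Fin n)} {C : BruhatChain n}
    (hC : IsMaximalChain u v C) (i : Fin (C.length + 1)) : BruhatLE (C i) v := by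
  induction i using Fin.reverseInduction with
  | last => exact hC.2 ▸ .refl _
  | cast i ih => exact (C.covBy i).1.1.trans ih

theorem valueColoring_succ_eq_iff {n : ℕ} {α : Type*} {f : Fin n → α} {C : BruhatChain n}
    {i : Fin C.length} {a b : Fin n} (h : (C i.castSucc)⁻¹ * C i.succ = swap a b) :
    valueColoring f (C i.succ) = valueColoring f (C i.castSucc) ↔ f a = f b := by
  rw [inv_mul_eq_iff_eq_mul.1 h, valueColoring_mul_swap_eq_iff]

/-- If a colouring of the positions is constant on the edges of the graph of one maximal chain,
then it induces the same value colouring for all elements of the interval. -/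
theorem IsMaximalChain.valueColoring_eq {n : ℕ} {α : Type*} {f : Fin n → α} {u v z : Perm (Fin n)}
    {C : BruhatChain n} (hC : IsMaximalChain u v C)
    (hf : ∀ a b, (chainGraph C).Adj a b → f a = f b)
    (huz : BruhatLE u z) (hzv : BruhatLE z v) : valueColoring f z = valueColoring f u := by
  have key : ∀ i : Fin (C.length + 1), ColorChain f u (C i) := by
    intro i
    induction i using Fin.induction with
    | zero => exact hC.1 ▸ .refl
    | succ i ih =>
      refine Relation.ReflTransGen.tail ih ⟨C.covBy i, ?_⟩
      obtain ⟨a, b, hab, h⟩ := (C.covBy i).exists_swap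
      have h' := inv_mul_eq_iff_eq_mul.2 h
      exact ((valueColoring_succ_eq_iff h').2 (hf a b ⟨hab, i, h'⟩)).symm
  exact ColorChain.valueColoring_eq (hC.2 ▸ key (Fin.last _)) huz hzv

/-- The labels of one maximal chain join positions lying in one component of the graph of any
other, since both chains stay in the same coset of the Young subgroup of that partition. -/
theorem IsMaximalChain.reachable_of_reachable {n : ℕ} {u v : Perm (Fin n)} {C D : BruhatChain n}
    (hC : IsMaximalChain u v C) (hD : IsMaximalChain u v D) {a b : Fin n}
    (h : (chainGraph D).Reachable a b) : (chainGraph C).Reachable a b := by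
  rw [SimpleGraph.reachable_iff_reflTransGen] at h
  induction h with
  | refl => exact .refl _
  | @tail b c _ hbc ih =>
    refine ih.trans ?_
    obtain ⟨-, i, h⟩ := hbc
    have hcol : ∀ j, valueColoring (chainGraph C).connectedComponentMk (D j) =
        valueColoring (chainGraph C).connectedComponentMk u := fun j =>
      hC.valueColoring_eq (fun _ _ h => SimpleGraph.ConnectedComponent.sound h.reachable)
        (hD.bruhatLE_apply j) (hD.apply_bruhatLE j)
    exact SimpleGraph.ConnectedComponent.exact
      ((valueColoring_succ_eq_iff h).1 ((hcol _).trans (hcol _).symm))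

theorem IsMaximalChain.chainPartition_eq {n : ℕ} {u v : Perm (Fin n)} {C D : BruhatChain n}
    (hC : IsMaximalChain u v C) (hD : IsMaximalChain u v D) :
    chainPartition C = chainPartition D := by
  have h : (chainGraph C).reachableSetoid = (chainGraph D).reachableSetoid :=
    Setoid.ext fun _ _ => ⟨hD.reachable_of_reachable hC, hC.reachable_of_reachable hD⟩
  unfold chainPartition
  congr!

theorem reachable_iff_mem_of_mem_chainPartition {n : ℕ} {C : BruhatChain n} {b : Finset (Fin n)}
    (hb : b ∈ (chainPartition C).parts) {i j : Fin n} (hi : i ∈ b) :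
    (chainGraph C).Reachable i j ↔ j ∈ b := by
  rw [← (chainPartition C).part_eq_of_mem hb hi]
  classical
  unfold chainPartition
  exact (Finpartition.mem_part_ofSetoid_iff_rel (s := (chainGraph C).reachableSetoid)).symm

theorem IsMaximalChain.sum_permVec_eq {n : ℕ} {u v z : Perm (Fin n)} {C : BruhatChain n}
    (hC : IsMaximalChain u v C) (huz : BruhatLE u z) (hzv : BruhatLE z v) {b : Finset (Fin n)}
    (hb : b ∈ (chainPartition C).parts) : ∑ i ∈ b, permVec z i = ∑ i ∈ b, permVec u i := by
  have hcol := hC.valueColoring_eq (f := (chainGraph C).connectedComponentMk)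
    (fun _ _ h => SimpleGraph.ConnectedComponent.sound h.reachable) huz hzv
  have hreach : ∀ i, (chainGraph C).Reachable i (u⁻¹ (z i)) := fun i => by
    have := congrFun hcol (z i)
    rw [valueColoring, valueColoring, Perm.inv_def, symm_apply_apply] at this
    exact SimpleGraph.ConnectedComponent.exact this
  refine Finset.sum_equiv (u⁻¹ * z) (fun i => ⟨fun hi => ?_, fun hi => ?_⟩) fun i _ => ?_
  · exact (reachable_iff_mem_of_mem_chainPartition hb hi).1 (hreach i)
  · exact (reachable_iff_mem_of_mem_chainPartition hb hi).1 (hreach i).symm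
  · simp [permVec]

/-! ### The linear algebra of block sums -/

/-- The linear map sending a vector to the sums of its coordinates over the blocks of a
partition. -/
def blockSum {ι : Type*} [Fintype ι] [DecidableEq ι] (P : Finpartition (Finset.univ : Finset ι)) :
    (ι → ℝ) →ₗ[ℝ] (P.parts → ℝ) where
  toFun x b := ∑ i ∈ b.1, x i
  map_add' x y := by funext b; simp [Finset.sum_add_distrib]
  map_smul' c x := by funext b; simp [Finset.mul_sum]

theorem blockSum_eq_iff {ι : Type*} [Fintype ι] [DecidableEq ι]
    {P : Finpartition (Finset.univ : Finset ι)} {x y : ι → ℝ} :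
    blockSum P x = blockSum P y ↔ ∀ b ∈ P.parts, ∑ i ∈ b, x i = ∑ i ∈ b, y i := by
  simp [funext_iff, blockSum]

theorem blockSum_surjective {ι : Type*} [Fintype ι] [DecidableEq ι]
    (P : Finpartition (Finset.univ : Finset ι)) : Function.Surjective (blockSum P) := by
  intro c
  refine ⟨fun i => c ⟨P.part i, P.part_mem.2 (Finset.mem_univ i)⟩ / (P.part i).card, ?_⟩
  funext ⟨b, hb⟩
  have hcard : (b.card : ℝ) ≠ 0 := by
    exact_mod_cast (Finset.card_pos.2 (P.nonempty_of_mem_parts hb)).ne'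
  calc ∑ i ∈ b, c ⟨P.part i, P.part_mem.2 (Finset.mem_univ i)⟩ / ((P.part i).card : ℝ)
      = ∑ i ∈ b, c ⟨b, hb⟩ / (b.card : ℝ) :=
        Finset.sum_congr rfl fun i hi => by simp only [P.part_eq_of_mem hb hi]
    _ = c ⟨b, hb⟩ := by rw [Finset.sum_const, nsmul_eq_mul, mul_div_cancel₀ _ hcard]

theorem finrank_ker_blockSum {ι : Type*} [Fintype ι] [DecidableEq ι]
    (P : Finpartition (Finset.univ : Finset ι)) :
    Module.finrank ℝ (LinearMap.ker (blockSum P)) + P.parts.card = Fintype.card ι := by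
  have h := LinearMap.finrank_range_add_finrank_ker (blockSum P)
  rw [LinearMap.range_eq_top.2 (blockSum_surjective P), finrank_top] at h
  simp only [Module.finrank_fintype_fun_eq_card, Fintype.card_coe] at h
  omega

/-- Vectors with vanishing block sums are combinations of differences of basis vectors taken from
the same block. -/
theorem ker_blockSum_le {ι : Type*} [Fintype ι] [DecidableEq ι]
    {P : Finpartition (Finset.univ : Finset ι)} {D : Submodule ℝ (ι → ℝ)}
    (hD : ∀ b ∈ P.parts, ∀ i ∈ b, ∀ j ∈ b, Pi.single i (1 : ℝ) - Pi.single j 1 ∈ D) :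
    LinearMap.ker (blockSum P) ≤ D := by
  intro y hy
  have hsum : ∑ b ∈ P.parts, ∑ i ∈ b, y i • (Pi.single i (1 : ℝ) : ι → ℝ) = y := by
    have h := Finset.sum_biUnion (s := P.parts) (t := id)
      (f := fun i => y i • (Pi.single i (1 : ℝ) : ι → ℝ)) P.disjoint
    rw [P.biUnion_parts] at h
    simp only [id] at h
    rw [← h]
    exact (pi_eq_sum_univ' y).symm
  rw [← hsum]
  refine D.sum_mem fun b hb => ?_
  obtain ⟨j, hj⟩ := P.nonempty_of_mem_parts hb
  have hb0 : ∑ i ∈ b, y i = 0 := congrFun (LinearMap.mem_ker.1 hy) ⟨b, hb⟩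
  have : ∑ i ∈ b, y i • (Pi.single i (1 : ℝ) : ι → ℝ) =
      ∑ i ∈ b, y i • (Pi.single i (1 : ℝ) - Pi.single j 1 : ι → ℝ) := by
    simp only [smul_sub, Finset.sum_sub_distrib]
    rw [← Finset.sum_smul, hb0, zero_smul, sub_zero]
  rw [this]
  exact D.sum_mem fun i hi => D.smul_mem _ (hD b hb i hi j hj)

/-! ### The affine span -/

theorem permVec_mul_swap_sub {n : ℕ} (x : Perm (Fin n)) (a b : Fin n) :
    permVec (x * swap a b) - permVec x =
      (permVec x b - permVec x a) • (Pi.single a (1 : ℝ) - Pi.single b 1 : Fin n → ℝ) := by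
  funext i
  simp only [permVec, Pi.sub_apply, Pi.smul_apply, Pi.single_apply, Perm.mul_apply,
    swap_apply_def, smul_eq_mul]
  split_ifs <;> simp_all

theorem permVec_injective {n : ℕ} (x : Perm (Fin n)) : Function.Injective (permVec x) :=
  fun i j h => x.injective (Fin.ext (by simpa [permVec] using h))

theorem IsMaximalChain.single_sub_single_mem {n : ℕ} {u v : Perm (Fin n)} {C : BruhatChain n}
    (hC : IsMaximalChain u v C) {a b : Fin n} (h : (chainGraph C).Reachable a b) :
    (Pi.single a (1 : ℝ) - Pi.single b 1 : Fin n → ℝ) ∈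
      (affineSpan ℝ (bruhatIntervalPolytope u v)).direction := by
  rw [SimpleGraph.reachable_iff_reflTransGen] at h
  induction h with
  | refl => simp
  | @tail b c _ hbc ih =>
    rw [← sub_add_sub_cancel _ (Pi.single b (1 : ℝ)) _]
    refine Submodule.add_mem _ ih ?_
    obtain ⟨hne, i, h⟩ := hbc
    have hmem : ∀ j, permVec (C j) ∈ affineSpan ℝ (bruhatIntervalPolytope u v) := fun j =>
      subset_affineSpan ℝ _ (subset_convexHull ℝ _
        ⟨C j, hC.bruhatLE_apply j, hC.apply_bruhatLE j, rfl⟩)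
    have hdir := AffineSubspace.vsub_mem_direction (hmem i.succ) (hmem i.castSucc)
    rw [vsub_eq_sub, inv_mul_eq_iff_eq_mul.1 h, permVec_mul_swap_sub] at hdir
    exact (Submodule.smul_mem_iff _
      (sub_ne_zero.2 fun he => hne (permVec_injective _ he).symm)).1 hdir

theorem IsMaximalChain.affineSpan_eq {n : ℕ} {u v : Perm (Fin n)} {C : BruhatChain n}
    (hC : IsMaximalChain u v C) (huv : BruhatLE u v) :
    affineSpan ℝ (bruhatIntervalPolytope u v) =
      AffineSubspace.mk' (permVec u) (LinearMap.ker (blockSum (chainPartition C))) := by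
  apply le_antisymm
  · rw [bruhatIntervalPolytope, affineSpan_convexHull, affineSpan_le]
    rintro _ ⟨z, huz, hzv, rfl⟩
    rw [SetLike.mem_coe, AffineSubspace.mem_mk', vsub_eq_sub, LinearMap.sub_mem_ker_iff,
      blockSum_eq_iff]
    exact fun b hb => hC.sum_permVec_eq huz hzv hb
  · intro x hx
    rw [AffineSubspace.mem_mk'] at hx
    have hu : permVec u ∈ affineSpan ℝ (bruhatIntervalPolytope u v) :=
      subset_affineSpan ℝ _ (subset_convexHull ℝ _ ⟨u, .refl u, huv, rfl⟩)
    refine (AffineSubspace.vsub_right_mem_direction_iff_mem hu x).1 (ker_blockSum_le ?_ hx)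
    exact fun b hb i hi j hj => hC.single_sub_single_mem
      ((reachable_iff_mem_of_mem_chainPartition hb hi).2 hj)

theorem mainTheorem3 (n : ℕ) (u v : Equiv.Perm (Fin n)) (huv : BruhatLE u v) :
    ∃ B : Finpartition (Finset.univ : Finset (Fin n)),
      (∃ C : BruhatChain n, IsMaximalChain u v C) ∧
      (∀ C : BruhatChain n, IsMaximalChain u v C → chainPartition C = B) ∧
      (Module.finrank ℝ (affineSpan ℝ (bruhatIntervalPolytope u v)).direction : ℤ)
        = (n : ℤ) - (B.parts.card : ℤ) ∧
      (affineSpan ℝ (bruhatIntervalPolytope u v) : Set (Fin n → ℝ))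
        = {x | ∀ b ∈ B.parts, ∑ i ∈ b, x i = ∑ i ∈ b, permVec u i} ∧
      (∀ b ∈ B.parts, ∑ i ∈ b, permVec u i = ∑ i ∈ b, permVec v i) := by
  obtain ⟨C, hC⟩ := exists_isMaximalChain huv
  refine ⟨chainPartition C, ⟨C, hC⟩, fun D hD => hD.chainPartition_eq hC, ?_, ?_,
    fun b hb => (hC.sum_permVec_eq huv (.refl v) hb).symm⟩
  · rw [hC.affineSpan_eq huv, AffineSubspace.direction_mk']
    have h := finrank_ker_blockSum (chainPartition C)
    rw [Fintype.card_fin] at h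
    omega
  · rw [hC.affineSpan_eq huv]
    ext x
    rw [SetLike.mem_coe, AffineSubspace.mem_mk', vsub_eq_sub, LinearMap.sub_mem_ker_iff,
      blockSum_eq_iff]
    rfl
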